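/- Let $X\in\mathbb{R}^{N\times d}$ and let $X=U\Sigma V^{\mathsf T}$ be a singular value decomposition: $U$ and $V$ have orthonormal columns and $\Sigma$ is (rectangular) diagonal with the singular values $\sigma_1\ge\sigma_2\ge\cdots\ge 0$ of $X$ on its diagonal in decreasing order (the compact decomposition, with $\operatorname{rk}X$ columns in $U$ and $V$, as well as larger ones up to the full decomposition are allowed); put $\sigma_j=0$ for $j>\operatorname{rk}X$. Let $k$ be at most the number of columns of $V$, let $V_k\in\mathbb{R}^{d\times k}$ consist of the first $k$ columns of $V$, and let $p$ be the number of nonzero rows of $V_k$ (the number of nonzero $k$-leverage scores). Let $y=Xw^*+\xi\in\mathbb{R}^N$ with $w^*\in\mathbb{R}^d$ fixed, where $\xi_1,\dots,\xi_N$ are i.i.d. real random variables with mean $0$ and finite variance $v$. For an estimator $w=w(X,y)\in\mathbb{R}^d$ let its excess risk be $$\mathcal{E}(w)=\mathbb{E}_{\xi}\left[\frac{\|Xw^*-Xw\|_2^2}{N}\right].$$ For $S\subset\{1,\dots,d\}$ let $\mathbf S\in\{0,1\}^{d\times|S|}$ be the sampling matrix with $X\mathbf S=X_{:,S}$, and let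 $\hat w_S=\mathbf S\,(X\mathbf S)^{+}y\in\mathbb{R}^d$, where $^+$ is the Moore–Penrose inverse; this is the least-squares regressor on the columns $X_{:,S}$, padded with zeros outside $S$. Let $S$ be a random subset of $\{1,\dots,d\}$ drawn from the projection determinantal point process with marginal kernel $K=V_kV_k^{\mathsf T}$, that is, $\mathbb{P}(T\subset S)=\det\big([K_{i,j}]_{i,j\in T}\big)$ for all $T\subset\{1,\dots,d\}$ (with $\det K_\emptyset=1$). Then $$\mathbb{E}_{\mathrm{DPP}}\big[\mathcal{E}(\hat w_S)\big]\;\le\;\big(1+k(p-k)\big)\frac{\|w^*\|_2^2\,\sigma_{k+1}^2}{N}+\frac{vk}{N}.$$ -/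

import Mathlib

open MeasureTheory ProbabilityTheory

namespace ColumnSubset

/-- The four Penrose equations: `B` is the Moore–Penrose inverse of the real matrix `A`. -/
structure IsMoorePenrose {m n : Type*} [Fintype m] [Fintype n]
    (A : Matrix m n ℝ) (B : Matrix n m ℝ) : Prop where
  mul_mul_left : A * B * A = A
  mul_mul_right : B * A * B = B
  transpose_left : (A * B).transpose = A * B
  transpose_right : (B * A).transpose = B * A

/-- The Moore–Penrose inverse `A⁺ = W diag(λ⁻¹) Wᵀ Aᵀ`, where `AᵀA = W diag(λ) Wᵀ` is the spectral
decomposition of `AᵀA`, and `0⁻¹ = 0`. See `isMoorePenrose_pinv` and `IsMoorePenrose.eq_pinv`. -/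
noncomputable def pinv {m n : Type*} [Fintype m] [Fintype n] [DecidableEq n]
    (A : Matrix m n ℝ) : Matrix n m ℝ :=
  (Matrix.isHermitian_conjTranspose_mul_self A).eigenvectorUnitary.val
    * Matrix.diagonal
        (fun i => ((Matrix.isHermitian_conjTranspose_mul_self A).eigenvalues i)⁻¹)
    * ((Matrix.isHermitian_conjTranspose_mul_self A).eigenvectorUnitary.val).transpose
    * A.transpose

theorem isMoorePenrose_pinv {m n : Type*} [Fintype m] [Fintype n] [DecidableEq n]
    (A : Matrix m n ℝ) : IsMoorePenrose A (pinv A) := by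
  set hG := Matrix.isHermitian_conjTranspose_mul_self A with hGdef
  set W : Matrix n n ℝ := hG.eigenvectorUnitary.val with hW
  set D : Matrix n n ℝ := Matrix.diagonal hG.eigenvalues with hD
  set D' : Matrix n n ℝ := Matrix.diagonal (fun i => (hG.eigenvalues i)⁻¹) with hD'
  have hWW : W.transpose * W = 1 := by
    have h := (Matrix.mem_unitaryGroup_iff' (A := W)).1 hG.eigenvectorUnitary.2
    rwa [Matrix.star_eq_conjTranspose, Matrix.conjTranspose_eq_transpose_of_trivial] at h
  have hspec : A.transpose * A = W * D * W.transpose := by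
    have h := hG.spectral_theorem
    rw [Unitary.conjStarAlgAut_apply, Matrix.star_eq_conjTranspose,
      Matrix.conjTranspose_eq_transpose_of_trivial hG.eigenvectorUnitary.val] at h
    exact (congrArg (· * A) (Matrix.conjTranspose_eq_transpose_of_trivial A)).symm.trans h
  have hp : pinv A = W * D' * W.transpose * A.transpose := rfl
  have hDD : D * D' * D = D := by
    simp only [hD, hD', Matrix.diagonal_mul_diagonal]
    congr 1; funext i; exact mul_inv_mul_cancel _
  have haux : ∀ x : ℝ, x⁻¹ * x * x⁻¹ = x⁻¹ := by
    intro x; by_cases h : x = 0 <;> simp [h]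
  have hDD' : D' * D * D' = D' := by
    simp only [hD, hD', Matrix.diagonal_mul_diagonal]
    congr 1; funext i; exact haux _
  have hcomm : D * D' = D' * D := by
    simp only [hD, hD', Matrix.diagonal_mul_diagonal]
    congr 1; funext i; exact mul_comm _ _
  have hDt : D.transpose = D := Matrix.diagonal_transpose _
  have hD't : D'.transpose = D' := Matrix.diagonal_transpose _
  have hconj : ∀ E F : Matrix n n ℝ,
      (W * E * W.transpose) * (W * F * W.transpose) = W * (E * F) * W.transpose := by
    intro E F
    calc (W * E * W.transpose) * (W * F * W.transpose)
        = W * E * (W.transpose * W) * F * W.transpose := by simp only [Matrix.mul_assoc]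
      _ = W * (E * F) * W.transpose := by rw [hWW]; simp only [Matrix.mul_one, Matrix.mul_assoc]
  have hBA : pinv A * A = W * (D' * D) * W.transpose := by
    rw [hp, Matrix.mul_assoc _ A.transpose A, hspec, hconj]
  refine ⟨?_, ?_, ?_, ?_⟩
  · have hz : (A * (pinv A * A) - A).conjTranspose * (A * (pinv A * A) - A) = 0 := by
      have h1 : A.transpose * (A * (pinv A * A) - A) = 0 := by
        rw [Matrix.mul_sub, ← Matrix.mul_assoc, hspec, hBA, hconj, ← Matrix.mul_assoc D, hDD,
          sub_self]
      have h2 : A * (pinv A * A) - A = A * (pinv A * A - 1) := by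
        rw [Matrix.mul_sub, Matrix.mul_one]
      conv_lhs => rw [h2]
      rw [Matrix.conjTranspose_mul, Matrix.conjTranspose_eq_transpose_of_trivial A,
        Matrix.mul_assoc, ← h2, h1, Matrix.mul_zero]
    rw [Matrix.mul_assoc]
    exact sub_eq_zero.1 (Matrix.conjTranspose_mul_self_eq_zero.1 hz)
  · rw [hBA, hp, ← Matrix.mul_assoc, hconj, hDD']
  · rw [hp]
    simp only [Matrix.transpose_mul, Matrix.transpose_transpose, hD't, Matrix.mul_assoc]
  · rw [hBA]
    simp only [Matrix.transpose_mul, Matrix.transpose_transpose, hD't, hDt, hcomm,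
      Matrix.mul_assoc]

theorem IsMoorePenrose.eq_pinv {m n : Type*} [Fintype m] [Fintype n] [DecidableEq n]
    {A : Matrix m n ℝ} {B : Matrix n m ℝ} (hB : IsMoorePenrose A B) : B = pinv A := by
  have hC := isMoorePenrose_pinv A
  set C := pinv A
  have h1 : A * B = A * C := by
    calc A * B = (A * B).transpose := hB.transpose_left.symm
      _ = (A * C * (A * B)).transpose := by
        rw [← Matrix.mul_assoc, hC.mul_mul_left]
      _ = A * B * (A * C) := by
        rw [Matrix.transpose_mul, hB.transpose_left, hC.transpose_left]
      _ = A * C := by rw [← Matrix.mul_assoc, hB.mul_mul_left]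
  have h2 : B * A = C * A := by
    calc B * A = (B * A).transpose := hB.transpose_right.symm
      _ = (B * A * (C * A)).transpose := by
        rw [Matrix.mul_assoc, ← Matrix.mul_assoc A C A, hC.mul_mul_left]
      _ = C * A * (B * A) := by
        rw [Matrix.transpose_mul, hB.transpose_right, hC.transpose_right]
      _ = C * A := by rw [Matrix.mul_assoc, ← Matrix.mul_assoc A B A, hB.mul_mul_left]
  calc B = B * A * B := hB.mul_mul_right.symm
    _ = C * A * B := by rw [h2]
    _ = C * (A * C) := by rw [Matrix.mul_assoc, h1]
    _ = C := by rw [← Matrix.mul_assoc, hC.mul_mul_right]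

/-- `sigma X j` is the `j`-th largest singular value of `X` for `j ≥ 1`, counted with multiplicity;
it is `0` for `j > rk X`. (Mathlib's sequence of singular values starts at index `0`.) -/
noncomputable def sigma {N d : ℕ} (X : Matrix (Fin N) (Fin d) ℝ) (j : ℕ) : ℝ :=
  (Matrix.toEuclideanLin X).singularValues (j - 1)

/-- `X = U Σ Vᵀ` is a singular value decomposition: `U` and `V` have orthonormal columns and `Σ` is
the `a × b` rectangular diagonal matrix with diagonal `σ₁(X) ≥ σ₂(X) ≥ ⋯`.
The compact decomposition is `a = b = rk X`, the full one is `a = N`, `b = d`. -/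
structure IsSVD {N d a b : ℕ} (X : Matrix (Fin N) (Fin d) ℝ)
    (U : Matrix (Fin N) (Fin a) ℝ) (V : Matrix (Fin d) (Fin b) ℝ) : Prop where
  orthonormal_left : U.transpose * U = 1
  orthonormal_right : V.transpose * V = 1
  eq_mul : X = U * Matrix.of (fun (i : Fin a) (j : Fin b) =>
      if (i : ℕ) = (j : ℕ) then sigma X ((j : ℕ) + 1) else 0) * V.transpose

/-- The first `k` columns of `V`. -/
def firstCols {d b k : ℕ} (V : Matrix (Fin d) (Fin b) ℝ) (hk : k ≤ b) :
    Matrix (Fin d) (Fin k) ℝ :=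
  V.submatrix id (Fin.castLE hk)

/-- The number of nonzero `k`-leverage scores, that is, of nonzero rows of `V_k`. -/
noncomputable def sparsityLevel {d k : ℕ} (Vk : Matrix (Fin d) (Fin k) ℝ) : ℕ :=
  {i : Fin d | Vk i ≠ 0}.ncard

/-- The law `μ` of a random subset `Y` of the index set is that of the determinantal point process
with marginal kernel `K`: `ℙ(T ⊆ Y) = det K_T` for all `T`. -/
def IsDPP {d : ℕ} (K : Matrix (Fin d) (Fin d) ℝ) (μ : PMF (Finset (Fin d))) : Prop :=
  ∀ T : Finset (Fin d),
    (∑ Y : Finset (Fin d) with T ⊆ Y, (μ Y).toReal) =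
      (K.submatrix (fun i : T => (i : Fin d)) (fun i : T => (i : Fin d))).det

/-- The expectation of `f Y` for a random subset `Y` with law `μ`. -/
noncomputable def expect {d : ℕ} (μ : PMF (Finset (Fin d))) (f : Finset (Fin d) → ℝ) : ℝ :=
  ∑ Y : Finset (Fin d), (μ Y).toReal * f Y

/-- The `d × |S|` zero-one sampling matrix of `S`, so that `M * samplingMatrix S = M_{:,S}`. -/
def samplingMatrix {d : ℕ} (S : Finset (Fin d)) : Matrix (Fin d) S ℝ :=
  (1 : Matrix (Fin d) (Fin d) ℝ).submatrix id (fun i : S => (i : Fin d))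

/-- The least-squares regressor of `y` on the columns `X_{:,S}`, as a vector of `ℝ^d`
supported on `S`. -/
noncomputable def sparseOLS {N d : ℕ} (X : Matrix (Fin N) (Fin d) ℝ) (S : Finset (Fin d))
    (y : EuclideanSpace ℝ (Fin N)) : EuclideanSpace ℝ (Fin d) :=
  WithLp.toLp 2 ((samplingMatrix S * pinv (X * samplingMatrix S)).mulVec y.ofLp)

/-- The response `y = X w* + ξ` of the well-specified linear model. -/
noncomputable def response {N d : ℕ} (X : Matrix (Fin N) (Fin d) ℝ)
    (wstar : EuclideanSpace ℝ (Fin d)) (noise : Fin N → ℝ) : EuclideanSpace ℝ (Fin N) :=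
  Matrix.toEuclideanLin X wstar + WithLp.toLp 2 noise

/-- The excess risk `𝔼_ξ [‖X w* - X w(y)‖² / N]` of an estimator `w` (a function of the response
`y = X w* + ξ`). -/
noncomputable def excessRisk {N d : ℕ} {Ω : Type*} [MeasurableSpace Ω] (P : Measure Ω)
    (X : Matrix (Fin N) (Fin d) ℝ) (wstar : EuclideanSpace ℝ (Fin d)) (ξ : Fin N → Ω → ℝ)
    (w : EuclideanSpace ℝ (Fin N) → EuclideanSpace ℝ (Fin d)) : ℝ :=
  ∫ ω, ‖Matrix.toEuclideanLin X wstar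
      - Matrix.toEuclideanLin X (w (response X wstar (fun i => ξ i ω)))‖ ^ 2 / (N : ℝ) ∂P

/-- The noises `ξ i` are i.i.d. with mean `0` and (finite) variance `v`. -/
structure IsIIDNoise {N : ℕ} {Ω : Type*} [MeasurableSpace Ω] (P : Measure Ω)
    (ξ : Fin N → Ω → ℝ) (v : ℝ) : Prop where
  indep : iIndepFun ξ P
  identDistrib : ∀ i j, IdentDistrib (ξ i) (ξ j) P P
  memLp : ∀ i, MemLp (ξ i) 2 P
  mean : ∀ i, (∫ ω, ξ i ω ∂P) = 0
  variance : ∀ i, ProbabilityTheory.variance (ξ i) P = v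

end ColumnSubset

/-! For fixed `S` the prediction is the orthogonal projection of `y` onto the span of the columns in
`S`. The risk therefore splits into a variance term, `v` times the rank of the projection and so at
most `v * k`, and the squared distance from `X w*` to that span. Any `q` supported on `S` bounds
this distance by `‖X (w* - q)‖`. Write `W` for `V_k` and choose `q` with `Wᵀ q = Wᵀ w* = u`: then
`w* - q` is orthogonal to the first `k` right singular vectors, and `X` costs only `σ_{k+1}`
(`IsSVD.mulVec_dotProduct_le`).

It remains to average `‖w* - q‖²`. The process gives a `k`-set `S` the probability `(det W_S)²`, and
by Cramer's rule `(det W_S)² ‖q‖²` is a sum of squared minors of `W` with one row replaced by `u`.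
Cauchy–Binet evaluates their sum, so `𝔼 ‖q‖² ≤ (p - k + 1) ‖u‖²` (`sum_sq_det_mul_interpVec_le`).
Both `w*` and `q` have projection `W u` onto the range of `W`; a weighted Young inequality for their
orthogonal parts gives the factor `1 + (p - k)`, which is at most `1 + k (p - k)`.

Averages over `k`-sets are written as sums over all maps `Fin k → Fin d`: non-injective maps have
zero minor, and each `k`-set is counted `k!` times. -/

namespace ColumnSubset

/-! ### Cauchy–Binet and minors with a replaced row -/

section CauchyBinet

variable {d k : ℕ}

theorem det_transpose_mul_eq_sum (B C : Matrix (Fin d) (Fin k) ℝ) :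
    (B.transpose * C).det =
      ∑ f : Fin k → Fin d, (∏ j, B (f j) j) * (C.submatrix f id).det := by
  have h := (Matrix.detRowAlternating (n := Fin k) (R := ℝ)).toMultilinearMap.map_sum
    (fun (j : Fin k) (i : Fin d) => B i j • C i)
  have h2 : (B.transpose * C) = fun j => ∑ i, B i j • C i := by
    ext j l
    simp [Matrix.mul_apply, Finset.sum_apply]
  rw [h2]
  refine h.trans (Finset.sum_congr rfl fun f _ => ?_)
  exact Matrix.det_mul_column (fun j => B (f j) j) (C.submatrix f id)

/-- The Cauchy–Binet formula, summed over all maps `Fin k → Fin d`. -/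
theorem sum_det_submatrix_mul (B C : Matrix (Fin d) (Fin k) ℝ) :
    ∑ f : Fin k → Fin d, (B.submatrix f id).det * (C.submatrix f id).det =
      (k.factorial : ℝ) * (B.transpose * C).det := by
  -- In the Leibniz expansion of the minor of `B`, the substitution `f ↦ f ∘ s` permutes the rows of
  -- the minor of `C`, which absorbs the sign of `s`. All `k!` permutations thus contribute equally.
  have key : ∀ s : Equiv.Perm (Fin k),
      ∑ f : Fin k → Fin d, ((Equiv.Perm.sign s : ℤ) : ℝ) * (∏ j, B (f (s j)) j) *
        (C.submatrix f id).det = (B.transpose * C).det := by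
    intro s
    rw [det_transpose_mul_eq_sum]
    refine Fintype.sum_equiv (Equiv.arrowCongr s.symm (Equiv.refl _)) _ _ fun f => ?_
    have h : (C.submatrix (f ∘ s) id).det =
        ((Equiv.Perm.sign s : ℤ) : ℝ) * (C.submatrix f id).det :=
      Matrix.det_permute s (C.submatrix f id)
    have h3 : (Equiv.arrowCongr s.symm (Equiv.refl (Fin d))) f = f ∘ s := rfl
    rw [h3, h]
    simp only [Function.comp_apply]
    ring
  calc _ = ∑ f : Fin k → Fin d, ∑ s : Equiv.Perm (Fin k),
        ((Equiv.Perm.sign s : ℤ) : ℝ) * (∏ j, B (f (s j)) j) * (C.submatrix f id).det := by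
        refine Finset.sum_congr rfl fun f _ => ?_
        rw [Matrix.det_apply' (B.submatrix f id), Finset.sum_mul]
        rfl
    _ = ∑ s : Equiv.Perm (Fin k), (B.transpose * C).det := by
        rw [Finset.sum_comm]
        exact Finset.sum_congr rfl fun s _ => key s
    _ = _ := by
        simp [Fintype.card_perm]

theorem sum_sq_det_submatrix (B : Matrix (Fin d) (Fin k) ℝ) :
    ∑ f : Fin k → Fin d, (B.submatrix f id).det ^ 2 =
      (k.factorial : ℝ) * (B.transpose * B).det := by
  rw [← sum_det_submatrix_mul]
  exact Finset.sum_congr rfl fun f _ => sq _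

/-- The Gram matrix is the rank-two perturbation `1 - W_i W_iᵀ + u uᵀ = 1 + P Q`, and `det (1 + P Q)
= det (1 + Q P)` reduces it to a 2 × 2 determinant. -/
theorem det_gram_updateRow {W : Matrix (Fin d) (Fin k) ℝ} (hW : W.transpose * W = 1)
    (i : Fin d) (u : Fin k → ℝ) :
    ((W.updateRow i u).transpose * W.updateRow i u).det =
      (1 - W i ⬝ᵥ W i) * (1 + u ⬝ᵥ u) + (W i ⬝ᵥ u) ^ 2 := by
  set P : Matrix (Fin k) (Fin 2) ℝ := Matrix.of fun j => ![-W i j, u j] with hP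
  set Q : Matrix (Fin 2) (Fin k) ℝ := Matrix.of ![W i, u] with hQ
  have h1 : (W.updateRow i u).transpose * W.updateRow i u = 1 + P * Q := by
    rw [← hW]
    ext j l
    simp only [Matrix.mul_apply, Matrix.transpose_apply, Matrix.add_apply, hP, hQ,
      Fin.sum_univ_two, Matrix.of_apply, Matrix.cons_val_zero, Matrix.cons_val_one]
    rw [← Finset.add_sum_erase _ _ (Finset.mem_univ i),
      ← Finset.add_sum_erase Finset.univ (fun x => W x j * W x l) (Finset.mem_univ i)]
    have h2 : ∑ x ∈ Finset.univ.erase i, W.updateRow i u x j * W.updateRow i u x l =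
        ∑ x ∈ Finset.univ.erase i, W x j * W x l := by
      refine Finset.sum_congr rfl fun x hx => ?_
      rw [Matrix.updateRow_ne (Finset.ne_of_mem_erase hx)]
    rw [h2, Matrix.updateRow_self]
    ring
  rw [h1, Matrix.det_one_add_mul_comm, Matrix.det_fin_two]
  have e : ∀ x y, (Q * P) x y = Q x ⬝ᵥ fun j => P j y := fun x y => rfl
  simp only [Matrix.add_apply, Matrix.one_apply, e]
  simp only [hP, hQ, Matrix.of_apply, Matrix.cons_val_zero, Matrix.cons_val_one, dotProduct,
    mul_neg, Finset.sum_neg_distrib, mul_comm (u _)]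
  norm_num
  ring

theorem submatrix_updateRow_of_notMem (W : Matrix (Fin d) (Fin k) ℝ) (i : Fin d) (u : Fin k → ℝ)
    {f : Fin k → Fin d} (hf : ∀ j, f j ≠ i) :
    (W.updateRow i u).submatrix f id = W.submatrix f id := by
  ext j l
  simp [Matrix.updateRow_ne (hf j)]

/-- The part of the Cauchy–Binet sum of `W` with row `i` replaced by `u` in which row `i` occurs. -/
theorem sum_sq_det_updateRow {W : Matrix (Fin d) (Fin k) ℝ} (hW : W.transpose * W = 1)
    (i : Fin d) (u : Fin k → ℝ) :
    (∑ f : Fin k → Fin d with i ∈ Set.range f, ((W.updateRow i u).submatrix f id).det ^ 2) =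
      (k.factorial : ℝ) * ((1 - W i ⬝ᵥ W i) * (u ⬝ᵥ u) + (W i ⬝ᵥ u) ^ 2) := by
  classical
  have h : ∀ x : Fin k → ℝ, (∑ f : Fin k → Fin d with i ∈ Set.range f,
        ((W.updateRow i x).submatrix f id).det ^ 2) +
      (∑ f : Fin k → Fin d with ¬ i ∈ Set.range f, (W.submatrix f id).det ^ 2) =
      (k.factorial : ℝ) * ((1 - W i ⬝ᵥ W i) * (1 + x ⬝ᵥ x) + (W i ⬝ᵥ x) ^ 2) := by
    intro x
    rw [← det_gram_updateRow hW, ← sum_sq_det_submatrix,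
      ← Finset.sum_filter_add_sum_filter_not Finset.univ (fun f : Fin k → Fin d => i ∈ Set.range f)]
    congr 1
    refine Finset.sum_congr rfl fun f hf => ?_
    rw [submatrix_updateRow_of_notMem]
    intro j hj
    exact (Finset.mem_filter.1 hf).2 ⟨j, hj⟩
  -- Maps avoiding `i` do not see the new row. Replacing it by `0` kills all the other terms, so
  -- subtracting the case `0` isolates the maps that hit `i`.
  have h0 := h 0
  have hz : (∑ f : Fin k → Fin d with i ∈ Set.range f,
        ((W.updateRow i 0).submatrix f id).det ^ 2) = 0 := by
    refine Finset.sum_eq_zero fun f hf => ?_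
    obtain ⟨j, hj⟩ := (Finset.mem_filter.1 hf).2
    rw [Matrix.det_eq_zero_of_row_eq_zero j, sq, zero_mul]
    intro l
    simp [hj]
  rw [hz] at h0
  have hu := h u
  simp only [dotProduct_zero] at h0
  linear_combination hu - h0

end CauchyBinet

/-! ### Mean squared norm of the interpolating vector and of its residual -/

section ObliqueProjection

variable {d k : ℕ}

/-- The solution `c` of `∑ j, c j • W (f j) = u` given by Cramer's rule. -/
noncomputable def interpCoeff (W : Matrix (Fin d) (Fin k) ℝ) (f : Fin k → Fin d)
    (u : Fin k → ℝ) : Fin k → ℝ :=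
  (W.submatrix f id).det⁻¹ • Matrix.cramer (W.submatrix f id).transpose u

/-- The vector supported on the range of `f` with the coefficients `interpCoeff W f u`; if `f` is
injective and the rows of `W` in its range form a basis, it is the only such vector `q` with
`Wᵀ q = u`. -/
noncomputable def interpVec (W : Matrix (Fin d) (Fin k) ℝ) (f : Fin k → Fin d)
    (u : Fin k → ℝ) : Fin d → ℝ :=
  ∑ j, Pi.single (f j) (interpCoeff W f u j)

theorem injective_of_det_submatrix_ne_zero {W : Matrix (Fin d) (Fin k) ℝ} {f : Fin k → Fin d}
    (h : (W.submatrix f id).det ≠ 0) : Function.Injective f := by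
  intro i j hij
  by_contra hne
  refine h (Matrix.det_zero_of_row_eq hne ?_)
  ext l
  simp [hij]

theorem transpose_mulVec_interpVec {W : Matrix (Fin d) (Fin k) ℝ} {f : Fin k → Fin d}
    (h : (W.submatrix f id).det ≠ 0) (u : Fin k → ℝ) :
    W.transpose.mulVec (interpVec W f u) = u := by
  have h1 : W.transpose.mulVec (interpVec W f u) =
      (W.submatrix f id).transpose.mulVec (interpCoeff W f u) := by
    ext l
    simp only [interpVec, Matrix.mulVec_sum, Finset.sum_apply]
    simp [Matrix.mulVec, dotProduct, Pi.single_apply]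
  rw [h1, interpCoeff, Matrix.mulVec_smul, Matrix.mulVec_cramer, Matrix.det_transpose, smul_smul,
    inv_mul_cancel₀ h, one_smul]

theorem interpVec_dotProduct_self {W : Matrix (Fin d) (Fin k) ℝ} {f : Fin k → Fin d}
    (h : (W.submatrix f id).det ≠ 0) (u : Fin k → ℝ) :
    interpVec W f u ⬝ᵥ interpVec W f u = interpCoeff W f u ⬝ᵥ interpCoeff W f u := by
  have hf := injective_of_det_submatrix_ne_zero h
  have h1 : ∀ j, interpVec W f u (f j) = interpCoeff W f u j := by
    intro j
    simp only [interpVec, Finset.sum_apply, Pi.single_apply, hf.eq_iff]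
    simp
  conv_lhs => rw [interpVec.eq_def W f u]
  rw [sum_dotProduct]
  simp only [single_dotProduct]
  refine Finset.sum_congr rfl fun j _ => ?_
  congr 1
  exact h1 j

open scoped Classical in
-- By Cramer's rule the minor times the `j`-th coefficient is the minor with row `f j` replaced by
-- `u`. A nonzero minor uses no zero row of `W`, so only the `p` nonzero rows enter; this is the
-- source of `p` in the bound.
theorem sq_det_mul_interpVec {W : Matrix (Fin d) (Fin k) ℝ} (f : Fin k → Fin d)
    (u : Fin k → ℝ) :
    (W.submatrix f id).det ^ 2 * (interpVec W f u ⬝ᵥ interpVec W f u) ≤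
      ∑ i : Fin d with W i ≠ 0, if i ∈ Set.range f then
        ((W.updateRow i u).submatrix f id).det ^ 2 else 0 := by
  by_cases h : (W.submatrix f id).det = 0
  · rw [h, sq, zero_mul, zero_mul]
    refine Finset.sum_nonneg fun i _ => ?_
    split_ifs <;> positivity
  have hf := injective_of_det_submatrix_ne_zero h
  rw [interpVec_dotProduct_self h]
  have h1 : (W.submatrix f id).det ^ 2 * (interpCoeff W f u ⬝ᵥ interpCoeff W f u) =
      ∑ j, ((W.updateRow (f j) u).submatrix f id).det ^ 2 := by
    rw [dotProduct, Finset.mul_sum]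
    refine Finset.sum_congr rfl fun j _ => ?_
    have h2 : (W.updateRow (f j) u).submatrix f id = (W.submatrix f id).updateRow j u := by
      ext a l
      by_cases ha : a = j
      · subst ha; simp
      · simp [Matrix.updateRow_ne ha, Matrix.updateRow_ne (hf.ne ha)]
    rw [h2, interpCoeff, Pi.smul_apply, Matrix.cramer_transpose_apply, smul_eq_mul]
    field_simp
  rw [h1]
  have h3 : ∑ j, ((W.updateRow (f j) u).submatrix f id).det ^ 2 =
      ∑ i ∈ Finset.univ.image f, if i ∈ Set.range f then
        ((W.updateRow i u).submatrix f id).det ^ 2 else 0 := by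
    rw [Finset.sum_image (fun a _ b _ hab => hf hab)]
    refine Finset.sum_congr rfl fun j _ => ?_
    rw [if_pos ⟨j, rfl⟩]
  rw [h3]
  refine Finset.sum_le_sum_of_subset_of_nonneg ?_ fun i _ _ => ?_
  · intro i hi
    obtain ⟨j, -, rfl⟩ := Finset.mem_image.1 hi
    refine Finset.mem_filter.2 ⟨Finset.mem_univ _, fun h0 => h ?_⟩
    exact Matrix.det_eq_zero_of_row_eq_zero j fun l => congrFun h0 l
  · split_ifs <;> positivity

open scoped Classical in
theorem sparsityLevel_eq_card (W : Matrix (Fin d) (Fin k) ℝ) :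
    sparsityLevel W = (Finset.univ.filter fun i : Fin d => W i ≠ 0).card := by
  rw [sparsityLevel, ← Set.ncard_coe_finset]
  congr 1
  ext i
  simp

open scoped Classical in
theorem sum_dotProduct_row_self {W : Matrix (Fin d) (Fin k) ℝ} (hW : W.transpose * W = 1) :
    (∑ i : Fin d with W i ≠ 0, W i ⬝ᵥ W i) = k := by
  have h : (W.transpose * W).trace = k := by rw [hW]; simp
  rw [Matrix.trace_mul_comm] at h
  rw [Finset.sum_filter_of_ne]
  · exact h
  · intro i _ hi h0
    exact hi (by rw [h0, zero_dotProduct])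

/-- `1 - ‖W_i‖²` is the Gram determinant of `W` with row `i` erased, hence a nonnegative multiple of
a sum of squared minors. -/
theorem dotProduct_row_self_le_one {W : Matrix (Fin d) (Fin k) ℝ} (hW : W.transpose * W = 1)
    (i : Fin d) : W i ⬝ᵥ W i ≤ 1 := by
  have h := sum_sq_det_submatrix (W.updateRow i 0)
  rw [det_gram_updateRow hW] at h
  simp only [dotProduct_zero] at h
  have h2 : 0 ≤ (k.factorial : ℝ) * ((1 - W i ⬝ᵥ W i) * (1 + 0) + 0 ^ 2) := by
    rw [← h]; exact Finset.sum_nonneg fun f _ => sq_nonneg _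
  have h3 := nonneg_of_mul_nonneg_right h2 (by positivity : (0 : ℝ) < k.factorial)
  linarith

/-- The leverage scores sum to `k`, each is at most `1`, and only `p` of them are nonzero. -/
theorem le_sparsityLevel {W : Matrix (Fin d) (Fin k) ℝ} (hW : W.transpose * W = 1) :
    (k : ℝ) ≤ sparsityLevel W := by
  rw [← sum_dotProduct_row_self hW, sparsityLevel_eq_card, Finset.card_eq_sum_ones, Nat.cast_sum]
  refine Finset.sum_le_sum fun i _ => ?_
  simpa using dotProduct_row_self_le_one hW i

theorem mulVec_dotProduct_mulVec {W : Matrix (Fin d) (Fin k) ℝ} (hW : W.transpose * W = 1)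
    (u u' : Fin k → ℝ) : W.mulVec u ⬝ᵥ W.mulVec u' = u ⬝ᵥ u' := by
  rw [Matrix.dotProduct_mulVec, ← Matrix.mulVec_transpose, Matrix.mulVec_mulVec, hW,
    Matrix.one_mulVec]

theorem sum_sq_det_mul_interpVec_le {W : Matrix (Fin d) (Fin k) ℝ} (hW : W.transpose * W = 1)
    (u : Fin k → ℝ) :
    ∑ f : Fin k → Fin d, (W.submatrix f id).det ^ 2 * (interpVec W f u ⬝ᵥ interpVec W f u) ≤
      (k.factorial : ℝ) * (((sparsityLevel W : ℝ) - k + 1) * (u ⬝ᵥ u)) := by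
  classical
  refine (Finset.sum_le_sum fun f _ => sq_det_mul_interpVec f u).trans ?_
  rw [Finset.sum_comm]
  simp only [← Finset.sum_filter]
  -- Over the nonzero rows, `∑ (1 - ‖W_i‖²) = p - k`, while `∑ (W_i ⬝ᵥ u)²` is at most `‖W u‖² =
  -- ‖u‖²`.
  rw [Finset.sum_congr rfl fun i _ => sum_sq_det_updateRow hW i u, ← Finset.mul_sum,
    Finset.sum_add_distrib, ← Finset.sum_mul, Finset.sum_sub_distrib, sum_dotProduct_row_self hW,
    Finset.sum_const, ← sparsityLevel_eq_card]
  have h : (∑ i : Fin d with W i ≠ 0, (W i ⬝ᵥ u) ^ 2) ≤ u ⬝ᵥ u := by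
    rw [← mulVec_dotProduct_mulVec hW]
    refine (Finset.sum_le_univ_sum_of_nonneg fun i => sq_nonneg _).trans (le_of_eq ?_)
    exact Finset.sum_congr rfl fun i _ => sq _
  refine mul_le_mul_of_nonneg_left ?_ (by positivity)
  simp only [nsmul_eq_mul, mul_one]
  linarith

theorem dotProduct_self_nonneg_real {n : ℕ} (x : Fin n → ℝ) : 0 ≤ x ⬝ᵥ x :=
  Finset.sum_nonneg fun i _ => mul_self_nonneg (x i)

/-- With `w = W u + a` and `q = W u + b`, where `a` and `b` are orthogonal to the range of `W`, the
right side minus the left side is `‖e a + b‖²`. -/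
theorem mul_residual_le {W : Matrix (Fin d) (Fin k) ℝ} (hW : W.transpose * W = 1)
    {w q : Fin d → ℝ} (hq : W.transpose.mulVec q = W.transpose.mulVec w) (e : ℝ) :
    e * ((w - q) ⬝ᵥ (w - q)) ≤
      (1 + e) * (e * (w ⬝ᵥ w - W.transpose.mulVec w ⬝ᵥ W.transpose.mulVec w) +
        (q ⬝ᵥ q - W.transpose.mulVec w ⬝ᵥ W.transpose.mulVec w)) := by
  set u := W.transpose.mulVec w with hu
  have h1 : ∀ x, x ⬝ᵥ W.mulVec u = W.transpose.mulVec x ⬝ᵥ u := by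
    intro x
    rw [Matrix.dotProduct_mulVec, ← Matrix.mulVec_transpose]
  have h2 := dotProduct_self_nonneg_real (e • (w - W.mulVec u) + (q - W.mulVec u))
  have hw := h1 w
  have hqq := h1 q
  rw [hq] at hqq
  rw [← hu] at hw
  have huu := mulVec_dotProduct_mulVec hW u u
  simp only [add_dotProduct, dotProduct_add, smul_dotProduct, dotProduct_smul, sub_dotProduct,
    dotProduct_sub, smul_eq_mul, dotProduct_comm (W.mulVec u) w, dotProduct_comm (W.mulVec u) q,
    dotProduct_comm q w, hw, hqq, huu] at h2 ⊢
  nlinarith [h2]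

/-- On average `‖b‖² ≤ (p - k) ‖u‖²` for the part `b` of the interpolating vector orthogonal to the
range of `W`. Hence `mul_residual_le` with `e` close to `p - k` balances the two terms into `(1 + e)
(‖w‖² - ‖u‖² + ‖u‖²)`. -/
theorem sum_sq_det_mul_residual_le {W : Matrix (Fin d) (Fin k) ℝ} (hW : W.transpose * W = 1)
    (w : Fin d → ℝ) :
    ∑ f : Fin k → Fin d, (W.submatrix f id).det ^ 2 *
        ((w - interpVec W f (W.transpose.mulVec w)) ⬝ᵥ
          (w - interpVec W f (W.transpose.mulVec w))) ≤
      (k.factorial : ℝ) * ((1 + k * ((sparsityLevel W : ℝ) - k)) * (w ⬝ᵥ w)) := by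
  set u := W.transpose.mulVec w with hu
  set p : ℝ := (sparsityLevel W : ℝ) with hp
  have hpk : (k : ℝ) ≤ p := le_sparsityLevel hW
  have hkf : (0 : ℝ) < k.factorial := by positivity
  set R := ∑ f : Fin k → Fin d, (W.submatrix f id).det ^ 2 *
        ((w - interpVec W f u) ⬝ᵥ (w - interpVec W f u)) with hR
  have htot : ∑ f : Fin k → Fin d, (W.submatrix f id).det ^ 2 = k.factorial := by
    rw [sum_sq_det_submatrix, hW, Matrix.det_one, mul_one]
  -- The strict inequality keeps `e` positive even if `p = k`; the value `e = p - k` is reached as a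
  -- limit.
  have hmain : ∀ e : ℝ, p - k < e → R ≤ k.factorial * ((1 + e) * (w ⬝ᵥ w)) := by
    intro e he
    have he0 : 0 < e := by linarith
    have h1 : e * R ≤ (1 + e) * (e * (w ⬝ᵥ w - u ⬝ᵥ u) * k.factorial +
        (k.factorial * ((p - k + 1) * (u ⬝ᵥ u)) - u ⬝ᵥ u * k.factorial)) := by
      calc e * R ≤ ∑ f : Fin k → Fin d, (1 + e) *
            (e * (w ⬝ᵥ w - u ⬝ᵥ u) * (W.submatrix f id).det ^ 2 +
              ((W.submatrix f id).det ^ 2 * (interpVec W f u ⬝ᵥ interpVec W f u) -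
                u ⬝ᵥ u * (W.submatrix f id).det ^ 2)) := by
            rw [hR, Finset.mul_sum]
            refine Finset.sum_le_sum fun f _ => ?_
            by_cases h : (W.submatrix f id).det = 0
            · simp [h]
            · have h3 := mul_residual_le hW (transpose_mulVec_interpVec h u) e
              rw [← hu] at h3
              have h4 := mul_le_mul_of_nonneg_left h3 (sq_nonneg (W.submatrix f id).det)
              linarith
        _ ≤ _ := by
            rw [← Finset.mul_sum, Finset.sum_add_distrib, Finset.sum_sub_distrib, ← Finset.mul_sum,
              ← Finset.mul_sum, htot]
            have h5 := sum_sq_det_mul_interpVec_le hW u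
            have h6 : 0 ≤ 1 + e := by linarith
            gcongr
    have huu := dotProduct_self_nonneg_real u
    have h2 : e * R ≤ e * (k.factorial * ((1 + e) * (w ⬝ᵥ w))) := by
      refine h1.trans ?_
      have h7 : 0 ≤ (1 + e) * k.factorial * ((e - (p - k)) * (u ⬝ᵥ u)) := by
        have : 0 ≤ e - (p - k) := by linarith
        positivity
      linarith
    exact le_of_mul_le_mul_left h2 he0
  have hww := dotProduct_self_nonneg_real w
  have hlim : R ≤ k.factorial * ((1 + (p - k)) * (w ⬝ᵥ w)) := by
    have hc : Filter.Tendsto (fun e : ℝ => k.factorial * ((1 + e) * (w ⬝ᵥ w)))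
        (nhdsWithin (p - k) (Set.Ioi (p - k)))
        (nhds (k.factorial * ((1 + (p - k)) * (w ⬝ᵥ w)))) :=
      ((by fun_prop : Continuous fun e : ℝ => k.factorial * ((1 + e) * (w ⬝ᵥ w))).tendsto
        _).mono_left nhdsWithin_le_nhds
    exact ge_of_tendsto hc (Filter.eventually_of_mem self_mem_nhdsWithin hmain)
  refine hlim.trans ?_
  -- For `k = 0` every row of `W` is empty, hence zero, and `p = 0`.
  have hk : p - k ≤ k * (p - k) := by
    rcases Nat.eq_zero_or_pos k with h0 | h0
    · subst h0
      have : p = 0 := by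
        classical
        rw [hp, sparsityLevel_eq_card, Finset.filter_false_of_mem]
        · simp
        · intro i _ h
          exact h (Subsingleton.elim _ _)
      simp [this]
    · have : (1 : ℝ) ≤ k := by exact_mod_cast h0
      nlinarith
  gcongr

end ObliqueProjection

/-! ### The projection process lives on `k`-sets, with squared minors as weights -/

section ProjectionDPP

variable {d k : ℕ}

theorem det_submatrix_mul_transpose_of_card_lt (W : Matrix (Fin d) (Fin k) ℝ)
    {T : Finset (Fin d)} (hT : k < T.card) :
    ((W * W.transpose).submatrix (fun i : T => (i : Fin d)) (fun i : T => (i : Fin d))).det = 0 := by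
  by_contra h
  have hu := (Matrix.isUnit_iff_isUnit_det _).2 (isUnit_iff_ne_zero.2 h)
  have h1 := Matrix.rank_of_isUnit _ hu
  have h2 : (W * W.transpose).submatrix (fun i : T => (i : Fin d)) (fun i : T => (i : Fin d)) =
      W.submatrix (fun i : T => (i : Fin d)) id * (W.submatrix (fun i : T => (i : Fin d)) id).transpose := by
    ext i j
    simp [Matrix.mul_apply]
  rw [h2] at h1
  have h3 := Matrix.rank_mul_le_left (W.submatrix (fun i : T => (i : Fin d)) id)
    (W.submatrix (fun i : T => (i : Fin d)) id).transpose
  have h4 := Matrix.rank_le_card_width (W.submatrix (fun i : T => (i : Fin d)) id)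
  rw [h1, Fintype.card_coe] at h3
  rw [Fintype.card_fin] at h4
  omega

theorem IsDPP.eq_zero_of_card_lt {W : Matrix (Fin d) (Fin k) ℝ} {μ : PMF (Finset (Fin d))}
    (hμ : IsDPP (W * W.transpose) μ) {T : Finset (Fin d)} (hT : k < T.card) :
    (μ T).toReal = 0 := by
  have h := hμ T
  rw [det_submatrix_mul_transpose_of_card_lt W hT] at h
  exact (Finset.sum_eq_zero_iff_of_nonneg fun _ _ => ENNReal.toReal_nonneg).1 h T
    (by simp)

theorem card_image_of_det_ne_zero {W : Matrix (Fin d) (Fin k) ℝ} {f : Fin k → Fin d}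
    (h : (W.submatrix f id).det ≠ 0) : (Finset.univ.image f).card = k := by
  rw [Finset.card_image_of_injective _ (injective_of_det_submatrix_ne_zero h), Finset.card_univ,
    Fintype.card_fin]

/-- Larger sets have probability zero, so for a `k`-set the probability of being included is that of
being the sample. -/
theorem IsDPP.eq_sq_det {W : Matrix (Fin d) (Fin k) ℝ} {μ : PMF (Finset (Fin d))}
    (hμ : IsDPP (W * W.transpose) μ) {f : Fin k → Fin d} (hf : Function.Injective f) :
    (μ (Finset.univ.image f)).toReal = (W.submatrix f id).det ^ 2 := by
  have h := hμ (Finset.univ.image f)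
  have hc : (Finset.univ.image f).card = k := by
    rw [Finset.card_image_of_injective _ hf, Finset.card_univ, Fintype.card_fin]
  rw [Finset.sum_eq_single_of_mem (Finset.univ.image f) (by simp)] at h
  · rw [h]
    let e : Fin k ≃ (Finset.univ.image f : Finset (Fin d)) := Equiv.ofBijective
      (fun j => ⟨f j, Finset.mem_image_of_mem f (Finset.mem_univ j)⟩)
      ⟨fun a b hab => hf (congrArg Subtype.val hab), fun ⟨i, hi⟩ => by
        obtain ⟨j, -, rfl⟩ := Finset.mem_image.1 hi
        exact ⟨j, rfl⟩⟩
    -- Enumerated by `f`, the kernel block is `W_f W_fᵀ`.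
    rw [← Matrix.det_submatrix_equiv_self e, sq]
    nth_rewrite 3 [← Matrix.det_transpose]
    rw [← Matrix.det_mul]
    rfl
  · intro Y hY hne
    refine hμ.eq_zero_of_card_lt ?_
    rw [← hc]
    exact Finset.card_lt_card (Finset.ssubset_iff_subset_ne.2 ⟨(Finset.mem_filter.1 hY).2, hne.symm⟩)

theorem card_filter_image_eq {S : Finset (Fin d)} (hS : S.card = k) :
    (Finset.univ.filter fun f : Fin k → Fin d => Finset.univ.image f = S).card = k.factorial := by
  have h : k.factorial = (Finset.univ : Finset (Equiv.Perm (Fin k))).card := by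
    rw [Finset.card_univ, Fintype.card_perm, Fintype.card_fin]
  rw [h]
  symm
  refine Finset.card_bij (fun s _ => S.orderEmbOfFin hS ∘ s) ?_ ?_ ?_
  · intro s _
    refine Finset.mem_filter.2 ⟨Finset.mem_univ _, ?_⟩
    rw [← Finset.image_image, Finset.image_univ_of_surjective s.surjective,
      Finset.image_orderEmbOfFin_univ]
  · intro s _ t _ hst
    ext j
    exact congrArg Fin.val ((S.orderEmbOfFin hS).injective (congrFun hst j))
  · intro f hf
    have hf := (Finset.mem_filter.1 hf).2
    have hinj : Function.Injective f := by
      rw [← Set.injOn_univ, ← Finset.coe_univ, ← Finset.card_image_iff, hf, hS, Finset.card_univ,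
        Fintype.card_fin]
    have hmem : ∀ j, f j ∈ S := fun j => hf ▸ Finset.mem_image_of_mem f (Finset.mem_univ j)
    let g : Fin k → Fin k := fun j => (S.orderIsoOfFin hS).symm ⟨f j, hmem j⟩
    have hg : Function.Injective g := fun a b hab =>
      hinj (congrArg Subtype.val ((S.orderIsoOfFin hS).symm.injective hab))
    refine ⟨Equiv.ofBijective g (Finite.injective_iff_bijective.1 hg), Finset.mem_univ _, ?_⟩
    ext j
    have : (S.orderIsoOfFin hS) (g j) = ⟨f j, hmem j⟩ := OrderIso.apply_symm_apply _ _
    simpa using congrArg (fun x : S => ((x : Fin d) : ℕ)) this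

theorem IsDPP.sum_sq_det_mul {W : Matrix (Fin d) (Fin k) ℝ} {μ : PMF (Finset (Fin d))}
    (hμ : IsDPP (W * W.transpose) μ) (F : Finset (Fin d) → ℝ) :
    ∑ f : Fin k → Fin d, (W.submatrix f id).det ^ 2 * F (Finset.univ.image f) =
      (k.factorial : ℝ) * ∑ S : Finset (Fin d) with S.card = k, (μ S).toReal * F S := by
  rw [← Finset.sum_fiberwise (s := Finset.univ) (g := fun f : Fin k → Fin d => Finset.univ.image f),
    Finset.sum_filter, Finset.mul_sum]
  refine Finset.sum_congr rfl fun S _ => ?_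
  split_ifs with hS
  · have h : ∀ f ∈ Finset.univ.filter (fun f : Fin k → Fin d => Finset.univ.image f = S),
        (W.submatrix f id).det ^ 2 * F (Finset.univ.image f) = (μ S).toReal * F S := by
      intro f hf
      have hf := (Finset.mem_filter.1 hf).2
      have hinj : Function.Injective f := by
        rw [← Set.injOn_univ, ← Finset.coe_univ, ← Finset.card_image_iff, hf, hS, Finset.card_univ,
          Fintype.card_fin]
      rw [← hμ.eq_sq_det hinj, hf]
    rw [Finset.sum_congr rfl h, Finset.sum_const, card_filter_image_eq hS, nsmul_eq_mul]
  · rw [mul_zero]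
    refine Finset.sum_eq_zero fun f hf => ?_
    have hf := (Finset.mem_filter.1 hf).2
    have : (W.submatrix f id).det = 0 := by
      by_contra h
      exact hS (hf ▸ card_image_of_det_ne_zero h)
    rw [this, sq, zero_mul, zero_mul]

theorem sum_toReal_eq_one (μ : PMF (Finset (Fin d))) : ∑ S, (μ S).toReal = 1 := by
  rw [← ENNReal.toReal_sum fun S _ => μ.apply_ne_top S, ← tsum_fintype (L := .unconditional _), μ.tsum_coe,
    ENNReal.toReal_one]

/-- By Cauchy–Binet the `k`-sets already carry the total mass `det (Wᵀ W) = 1`. -/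
theorem IsDPP.eq_zero_of_card_ne {W : Matrix (Fin d) (Fin k) ℝ} (hW : W.transpose * W = 1)
    {μ : PMF (Finset (Fin d))} (hμ : IsDPP (W * W.transpose) μ) {S : Finset (Fin d)}
    (hS : S.card ≠ k) : (μ S).toReal = 0 := by
  have hkf : (k.factorial : ℝ) ≠ 0 := by positivity
  have h := hμ.sum_sq_det_mul (fun _ => 1)
  simp only [mul_one] at h
  rw [sum_sq_det_submatrix, hW, Matrix.det_one] at h
  have h1 := mul_left_cancel₀ hkf h
  have h2 := Finset.sum_filter_add_sum_filter_not Finset.univ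
    (fun S : Finset (Fin d) => S.card = k) (fun S => (μ S).toReal)
  rw [← h1, sum_toReal_eq_one] at h2
  exact (Finset.sum_eq_zero_iff_of_nonneg fun _ _ => ENNReal.toReal_nonneg).1
    (by linarith) S (Finset.mem_filter.2 ⟨Finset.mem_univ _, hS⟩)

/-- The expectation under the projection process, as a sum over enumerations of the subset. -/
theorem IsDPP.factorial_mul_expect {W : Matrix (Fin d) (Fin k) ℝ} (hW : W.transpose * W = 1)
    {μ : PMF (Finset (Fin d))} (hμ : IsDPP (W * W.transpose) μ) (F : Finset (Fin d) → ℝ) :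
    (k.factorial : ℝ) * expect μ F =
      ∑ f : Fin k → Fin d, (W.submatrix f id).det ^ 2 * F (Finset.univ.image f) := by
  rw [hμ.sum_sq_det_mul, expect, Finset.sum_filter_of_ne]
  intro S _ h
  by_contra hS
  exact h (by rw [hμ.eq_zero_of_card_ne hW hS, zero_mul])

end ProjectionDPP

/-! ### Contraction of `X` off the leading singular vectors -/

section SingularValueBound

variable {N d a b k : ℕ}

theorem transpose_mulVec_dotProduct_le {V : Matrix (Fin d) (Fin b) ℝ}
    (hV : V.transpose * V = 1) (z : Fin d → ℝ) :
    V.transpose.mulVec z ⬝ᵥ V.transpose.mulVec z ≤ z ⬝ᵥ z := by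
  have h := dotProduct_self_nonneg_real (z - V.mulVec (V.transpose.mulVec z))
  have h1 : z ⬝ᵥ V.mulVec (V.transpose.mulVec z) =
      V.transpose.mulVec z ⬝ᵥ V.transpose.mulVec z := by
    rw [Matrix.dotProduct_mulVec, ← Matrix.mulVec_transpose]
  simp only [sub_dotProduct, dotProduct_sub, mulVec_dotProduct_mulVec hV, h1,
    dotProduct_comm (V.mulVec (V.transpose.mulVec z)) z] at h
  linarith

theorem sigma_nonneg (X : Matrix (Fin N) (Fin d) ℝ) (j : ℕ) : 0 ≤ sigma X j :=
  LinearMap.singularValues_nonneg _ _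

theorem sigma_antitone (X : Matrix (Fin N) (Fin d) ℝ) : Antitone (sigma X) := fun _ _ h =>
  LinearMap.singularValues_antitone _ (Nat.sub_le_sub_right h 1)

theorem firstCols_transpose_mul_self {V : Matrix (Fin d) (Fin b) ℝ}
    (hV : V.transpose * V = 1) (hk : k ≤ b) :
    (firstCols V hk).transpose * firstCols V hk = 1 := by
  have h : (firstCols V hk).transpose * firstCols V hk =
      (V.transpose * V).submatrix (Fin.castLE hk) (Fin.castLE hk) := by
    ext i j
    simp [firstCols, Matrix.mul_apply]
  rw [h, hV, Matrix.submatrix_one _ (Fin.castLE_injective hk)]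

/-- On the orthogonal complement of the first `k` right singular vectors, `X` contracts by at least
the `(k + 1)`-st singular value. -/
theorem IsSVD.mulVec_dotProduct_le {X : Matrix (Fin N) (Fin d) ℝ}
    {U : Matrix (Fin N) (Fin a) ℝ} {V : Matrix (Fin d) (Fin b) ℝ} (h : IsSVD X U V)
    (hk : k ≤ b) {z : Fin d → ℝ} (hz : (firstCols V hk).transpose.mulVec z = 0) :
    X.mulVec z ⬝ᵥ X.mulVec z ≤ sigma X (k + 1) ^ 2 * (z ⬝ᵥ z) := by
  set D : Matrix (Fin a) (Fin b) ℝ := Matrix.of (fun (i : Fin a) (j : Fin b) =>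
      if (i : ℕ) = (j : ℕ) then sigma X ((j : ℕ) + 1) else 0) with hD
  set t := V.transpose.mulVec z with ht
  have ht0 : ∀ j : Fin b, (j : ℕ) < k → t j = 0 := fun j hj => congrFun hz ⟨j, hj⟩
  have h1 : X.mulVec z = U.mulVec (D.mulVec t) := by
    rw [ht, Matrix.mulVec_mulVec, Matrix.mulVec_mulVec]
    exact congrArg (fun M => Matrix.mulVec M z) h.eq_mul
  rw [h1, mulVec_dotProduct_mulVec h.orthonormal_left]
  -- Writing the bound as a sum over `j` lets the two sums be swapped whatever the shape of `D`:
  -- rows `i ≥ b` vanish, and columns `j ≥ a` meet no diagonal entry.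
  have h2 : ∀ i, D.mulVec t i * D.mulVec t i ≤
      ∑ j : Fin b, if (i : ℕ) = (j : ℕ) then sigma X (k + 1) ^ 2 * (t j * t j) else 0 := by
    intro i
    by_cases hi : (i : ℕ) < b
    · have e1 : D.mulVec t i = sigma X ((i : ℕ) + 1) * t ⟨i, hi⟩ := by
        rw [Matrix.mulVec, dotProduct, Finset.sum_eq_single_of_mem ⟨i, hi⟩ (Finset.mem_univ _)]
        · simp [hD]
        · intro j _ hj
          have : ¬ (i : ℕ) = j := fun hh => hj (Fin.ext hh.symm)
          simp [hD, this]
      refine le_trans ?_ (Finset.single_le_sum (f := fun j : Fin b =>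
        if (i : ℕ) = (j : ℕ) then sigma X (k + 1) ^ 2 * (t j * t j) else 0)
        (fun j _ => ?_) (Finset.mem_univ (⟨i, hi⟩ : Fin b)))
      · rw [e1, if_pos rfl]
        by_cases hik : (i : ℕ) < k
        · rw [ht0 ⟨i, hi⟩ hik]; simp
        · have e2 := sigma_antitone X (by omega : k + 1 ≤ (i : ℕ) + 1)
          have e3 := pow_le_pow_left₀ (sigma_nonneg X _) e2 2
          have e4 := mul_le_mul_of_nonneg_right e3 (mul_self_nonneg (t ⟨i, hi⟩))
          linarith
      · have := mul_self_nonneg (t j)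
        split_ifs <;> positivity
    · have e1 : D.mulVec t i = 0 := by
        rw [Matrix.mulVec, dotProduct]
        refine Finset.sum_eq_zero fun j _ => ?_
        have : ¬ (i : ℕ) = j := by have := j.2; omega
        simp [hD, this]
      rw [e1, mul_zero]
      refine Finset.sum_nonneg fun j _ => ?_
      have := mul_self_nonneg (t j)
      split_ifs <;> positivity
  calc D.mulVec t ⬝ᵥ D.mulVec t ≤ ∑ i : Fin a, ∑ j : Fin b,
        (if (i : ℕ) = (j : ℕ) then sigma X (k + 1) ^ 2 * (t j * t j) else 0) :=
        Finset.sum_le_sum fun i _ => h2 i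
    _ ≤ ∑ j : Fin b, sigma X (k + 1) ^ 2 * (t j * t j) := by
        rw [Finset.sum_comm]
        refine Finset.sum_le_sum fun j _ => ?_
        have hn : 0 ≤ sigma X (k + 1) ^ 2 * (t j * t j) :=
          mul_nonneg (sq_nonneg _) (mul_self_nonneg _)
        by_cases hj : (j : ℕ) < a
        · rw [Finset.sum_eq_single_of_mem ⟨j, hj⟩ (Finset.mem_univ _)]
          · simp
          · intro i _ hi
            exact if_neg fun hh => hi (Fin.ext hh)
        · rw [Finset.sum_eq_zero]
          · exact hn
          · intro i _
            exact if_neg (by have := i.2; omega)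
    _ = sigma X (k + 1) ^ 2 * (t ⬝ᵥ t) := by rw [← Finset.mul_sum]; rfl
    _ ≤ _ := mul_le_mul_of_nonneg_left (transpose_mulVec_dotProduct_le h.orthonormal_right z)
        (sq_nonneg _)

end SingularValueBound

/-! ### Orthogonal projections from the Moore–Penrose inverse -/

section Projection

variable {m n : Type*} [Fintype m] [Fintype n]

/-- The trace equals that of the orthogonal projection `Q = A⁺ A`, whose diagonal entries satisfy
`Q_ii = ∑ j, Q_ij² ≥ Q_ii²` and so are at most `1`. -/
theorem trace_mul_pinv_le [DecidableEq n] (A : Matrix m n ℝ) : (A * pinv A).trace ≤ Fintype.card n := by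
  have h := isMoorePenrose_pinv A
  rw [Matrix.trace_mul_comm, Fintype.card_eq_sum_ones, Nat.cast_sum]
  refine Finset.sum_le_sum fun i _ => ?_
  set Q := pinv A * A with hQ
  have hQQ : Q * Q = Q := by
    rw [hQ, ← Matrix.mul_assoc, h.mul_mul_right]
  have hQt : ∀ i j, Q j i = Q i j := fun i j => congrFun (congrFun h.transpose_right i) j
  have h1 : Q i i = ∑ j, Q i j ^ 2 := by
    conv_lhs => rw [← hQQ, Matrix.mul_apply]
    exact Finset.sum_congr rfl fun j _ => by rw [hQt i j, sq]
  have h2 : Q i i ^ 2 ≤ Q i i := by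
    conv_rhs => rw [h1]
    exact Finset.single_le_sum (f := fun j => Q i j ^ 2) (fun j _ => sq_nonneg _)
      (Finset.mem_univ i)
  simp only [Matrix.diag_apply, Nat.cast_one]
  nlinarith

theorem IsMoorePenrose.mulVec_dotProduct_mulVec {A : Matrix m n ℝ} {B : Matrix n m ℝ}
    (h : IsMoorePenrose A B) (x y : m → ℝ) :
    (A * B).mulVec x ⬝ᵥ (A * B).mulVec y = x ⬝ᵥ (A * B).mulVec y := by
  rw [dotProduct_comm, Matrix.dotProduct_mulVec, ← Matrix.mulVec_transpose, h.transpose_left,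
    Matrix.mulVec_mulVec, ← Matrix.mul_assoc, h.mul_mul_left, dotProduct_comm]

/-- `A B` fixes the range of `A`, so `x` and `x - A z` have the same residual, and taking residuals
does not increase the norm. -/
theorem IsMoorePenrose.residual_dotProduct_le {A : Matrix m n ℝ} {B : Matrix n m ℝ}
    (h : IsMoorePenrose A B) (x : m → ℝ) (z : n → ℝ) :
    (x - (A * B).mulVec x) ⬝ᵥ (x - (A * B).mulVec x) ≤
      (x - A.mulVec z) ⬝ᵥ (x - A.mulVec z) := by
  set x' := x - A.mulVec z with hx'
  have h1 : x - (A * B).mulVec x = x' - (A * B).mulVec x' := by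
    rw [hx', Matrix.mulVec_sub, Matrix.mulVec_mulVec, h.mul_mul_left]
    abel
  have h2 := h.mulVec_dotProduct_mulVec x' x'
  have h3 : 0 ≤ (A * B).mulVec x' ⬝ᵥ (A * B).mulVec x' :=
    Finset.sum_nonneg fun i _ => mul_self_nonneg _
  rw [h1]
  simp only [sub_dotProduct, dotProduct_sub, dotProduct_comm ((A * B).mulVec x') x', h2] at h3 ⊢
  linarith

theorem IsMoorePenrose.prediction_error_eq {A : Matrix m n ℝ} {B : Matrix n m ℝ}
    (h : IsMoorePenrose A B) (x e : m → ℝ) :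
    (x - (A * B).mulVec (x + e)) ⬝ᵥ (x - (A * B).mulVec (x + e)) =
      (x - (A * B).mulVec x) ⬝ᵥ (x - (A * B).mulVec x) + e ⬝ᵥ (A * B).mulVec e := by
  have h1 := h.mulVec_dotProduct_mulVec x e
  have h2 := h.mulVec_dotProduct_mulVec e e
  simp only [Matrix.mulVec_add, sub_dotProduct, dotProduct_sub, add_dotProduct, dotProduct_add,
    dotProduct_comm ((A * B).mulVec e) x, dotProduct_comm ((A * B).mulVec e) ((A * B).mulVec x),
    h1, h2]
  ring

end Projection

/-! ### Bias and variance of least squares on selected columns -/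

section Risk

variable {N d : ℕ} {Ω : Type*} [MeasurableSpace Ω] {P : Measure Ω}

theorem IsIIDNoise.integrable_mul {ξ : Fin N → Ω → ℝ} {v : ℝ} (hξ : IsIIDNoise P ξ v)
    (i j : Fin N) : Integrable (fun ω => ξ i ω * ξ j ω) P :=
  (hξ.memLp i).integrable_mul (hξ.memLp j)

theorem IsIIDNoise.integral_mul {ξ : Fin N → Ω → ℝ} {v : ℝ} (hξ : IsIIDNoise P ξ v)
    (i j : Fin N) : ∫ ω, ξ i ω * ξ j ω ∂P = if i = j then v else 0 := by
  split_ifs with h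
  · subst h
    rw [← hξ.variance i, variance_of_integral_eq_zero (hξ.memLp i).aemeasurable (hξ.mean i)]
    simp only [sq]
  · have h1 := (hξ.indep.indepFun h).integral_mul_eq_mul_integral
      (hξ.memLp i).aestronglyMeasurable (hξ.memLp j).aestronglyMeasurable
    simp only [hξ.mean, mul_zero] at h1
    exact h1

theorem dotProduct_mulVec_eq_sum (Q : Matrix (Fin N) (Fin N) ℝ) (x : Fin N → ℝ) :
    x ⬝ᵥ Q.mulVec x = ∑ i, ∑ j, Q i j * (x i * x j) := by
  simp only [Matrix.mulVec, dotProduct, Finset.mul_sum]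
  exact Finset.sum_congr rfl fun i _ => Finset.sum_congr rfl fun j _ => by ring

theorem IsIIDNoise.integrable_quadratic {ξ : Fin N → Ω → ℝ} {v : ℝ} (hξ : IsIIDNoise P ξ v)
    (Q : Matrix (Fin N) (Fin N) ℝ) :
    Integrable (fun ω => (fun i => ξ i ω) ⬝ᵥ Q.mulVec fun i => ξ i ω) P := by
  simp only [dotProduct_mulVec_eq_sum]
  exact integrable_finsetSum _ fun i _ => integrable_finsetSum _ fun j _ =>
    (hξ.integrable_mul i j).const_mul (Q i j)

theorem IsIIDNoise.integral_quadratic {ξ : Fin N → Ω → ℝ} {v : ℝ} (hξ : IsIIDNoise P ξ v)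
    (Q : Matrix (Fin N) (Fin N) ℝ) :
    ∫ ω, (fun i => ξ i ω) ⬝ᵥ Q.mulVec (fun i => ξ i ω) ∂P = v * Q.trace := by
  simp only [dotProduct_mulVec_eq_sum]
  have h1 : ∀ i j, Integrable (fun ω => Q i j * (ξ i ω * ξ j ω)) P := fun i j =>
    (hξ.integrable_mul i j).const_mul (Q i j)
  rw [integral_finsetSum Finset.univ fun i _ => integrable_finsetSum Finset.univ fun j _ => h1 i j]
  have h2 : ∀ i, ∫ ω, ∑ j, Q i j * (ξ i ω * ξ j ω) ∂P = v * Q i i := by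
    intro i
    rw [integral_finsetSum Finset.univ fun j _ => h1 i j]
    simp only [integral_const_mul, hξ.integral_mul]
    simp [mul_comm v]
  simp only [h2, Matrix.trace, Matrix.diag_apply, Finset.mul_sum]

theorem norm_toLp_sq (x : Fin N → ℝ) : ‖WithLp.toLp 2 x‖ ^ 2 = x ⬝ᵥ x := by
  rw [EuclideanSpace.real_norm_sq_eq]
  exact Finset.sum_congr rfl fun i _ => sq _

/-- Bias–variance decomposition of the excess risk of least squares on the columns in `S`. -/
theorem excessRisk_sparseOLS [IsProbabilityMeasure P] {ξ : Fin N → Ω → ℝ} {v : ℝ} (hξ : IsIIDNoise P ξ v)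
    (X : Matrix (Fin N) (Fin d) ℝ) (wstar : EuclideanSpace ℝ (Fin d)) (S : Finset (Fin d)) :
    excessRisk P X wstar ξ (sparseOLS X S) =
      ((X.mulVec wstar.ofLp - (X * samplingMatrix S * pinv (X * samplingMatrix S)).mulVec
          (X.mulVec wstar.ofLp)) ⬝ᵥ
        (X.mulVec wstar.ofLp - (X * samplingMatrix S * pinv (X * samplingMatrix S)).mulVec
          (X.mulVec wstar.ofLp)) +
        v * (X * samplingMatrix S * pinv (X * samplingMatrix S)).trace) / N := by
  have h : ∀ ω, ‖Matrix.toEuclideanLin X wstar - Matrix.toEuclideanLin X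
      (sparseOLS X S (response X wstar fun i => ξ i ω))‖ ^ 2 =
      (X.mulVec wstar.ofLp - (X * samplingMatrix S * pinv (X * samplingMatrix S)).mulVec
          (X.mulVec wstar.ofLp)) ⬝ᵥ
        (X.mulVec wstar.ofLp - (X * samplingMatrix S * pinv (X * samplingMatrix S)).mulVec
          (X.mulVec wstar.ofLp)) +
      (fun i => ξ i ω) ⬝ᵥ (X * samplingMatrix S * pinv (X * samplingMatrix S)).mulVec
        fun i => ξ i ω := by
    intro ω
    rw [← (isMoorePenrose_pinv (X * samplingMatrix S)).prediction_error_eq, ← norm_toLp_sq]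
    congr 2
    simp [sparseOLS, response, Matrix.toLpLin_apply, Matrix.mulVec_mulVec,
      Matrix.mul_assoc]
  simp only [excessRisk, h, integral_div]
  rw [integral_add (integrable_const _) (hξ.integrable_quadratic _), hξ.integral_quadratic]
  simp

theorem excessRisk_sparseOLS_le [IsProbabilityMeasure P] {ξ : Fin N → Ω → ℝ} {v : ℝ} (hξ : IsIIDNoise P ξ v)
    (X : Matrix (Fin N) (Fin d) ℝ) (wstar : EuclideanSpace ℝ (Fin d)) (S : Finset (Fin d))
    {q : Fin d → ℝ} (hq : ∀ i ∉ S, q i = 0) :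
    excessRisk P X wstar ξ (sparseOLS X S) ≤
      (X.mulVec (wstar.ofLp - q) ⬝ᵥ X.mulVec (wstar.ofLp - q) + v * S.card) / N := by
  -- For `N = 0` both sides vanish by division by zero, and there is no noise variable from which to
  -- read off `0 ≤ v`.
  rcases Nat.eq_zero_or_pos N with h0 | hN
  · subst h0
    simp [excessRisk]
  have hv : 0 ≤ v := by
    rw [← hξ.variance ⟨0, hN⟩]
    exact variance_nonneg _ _
  rw [excessRisk_sparseOLS hξ]
  have hqS : (samplingMatrix S).mulVec (fun i : S => q i) = q := by
    ext i
    simp only [samplingMatrix, Matrix.mulVec, dotProduct, Matrix.submatrix_apply, id_eq,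
      Matrix.one_apply, ite_mul, one_mul, zero_mul]
    rw [Finset.sum_coe_sort S (fun j => if i = j then q j else 0), Finset.sum_ite_eq]
    split_ifs with hi
    · rfl
    · exact (hq i hi).symm
  have h1 := (isMoorePenrose_pinv (X * samplingMatrix S)).residual_dotProduct_le
    (X.mulVec wstar.ofLp) (fun i : S => q i)
  rw [← Matrix.mulVec_mulVec (fun i : S => q i) X, hqS, ← Matrix.mulVec_sub] at h1
  have h2 := trace_mul_pinv_le (X * samplingMatrix S)
  rw [Fintype.card_coe] at h2
  gcongr

end Risk

end ColumnSubset

/-! ### The risk bound -/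

theorem mainTheorem4 {N d a b k : ℕ} (X : Matrix (Fin N) (Fin d) ℝ)
    (U : Matrix (Fin N) (Fin a) ℝ) (V : Matrix (Fin d) (Fin b) ℝ)
    (hSVD : ColumnSubset.IsSVD X U V) (hk : k ≤ b)
    (μ : PMF (Finset (Fin d)))
    (hμ : ColumnSubset.IsDPP
      (ColumnSubset.firstCols V hk * (ColumnSubset.firstCols V hk).transpose) μ)
    {Ω : Type*} [MeasurableSpace Ω] (P : MeasureTheory.Measure Ω)
    [MeasureTheory.IsProbabilityMeasure P]
    (ξ : Fin N → Ω → ℝ) (v : ℝ) (hξ : ColumnSubset.IsIIDNoise P ξ v)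
    (wstar : EuclideanSpace ℝ (Fin d)) :
    ColumnSubset.expect μ
        (fun S => ColumnSubset.excessRisk P X wstar ξ (ColumnSubset.sparseOLS X S)) ≤
      (1 + (k : ℝ) *
          ((ColumnSubset.sparsityLevel (ColumnSubset.firstCols V hk) : ℝ) - (k : ℝ))) *
        (‖wstar‖ ^ 2 * ColumnSubset.sigma X (k + 1) ^ 2 / (N : ℝ)) + v * (k : ℝ) / (N : ℝ) := by
  have hW := ColumnSubset.firstCols_transpose_mul_self hSVD.orthonormal_right hk
  set W := ColumnSubset.firstCols V hk with hWdef
  have hkf : (0 : ℝ) < k.factorial := by positivity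
  refine le_of_mul_le_mul_left ?_ hkf
  rw [hμ.factorial_mul_expect hW]
  set s := ColumnSubset.sigma X (k + 1) with hs
  set w := wstar.ofLp with hw
  have hnorm : ‖wstar‖ ^ 2 = w ⬝ᵥ w := ColumnSubset.norm_toLp_sq w
  set q : (Fin k → Fin d) → Fin d → ℝ := fun f =>
    ColumnSubset.interpVec W f (W.transpose.mulVec w) with hq
  calc ∑ f : Fin k → Fin d, (W.submatrix f id).det ^ 2 *
        ColumnSubset.excessRisk P X wstar ξ (ColumnSubset.sparseOLS X (Finset.univ.image f))
      ≤ ∑ f : Fin k → Fin d, (s ^ 2 / N * ((W.submatrix f id).det ^ 2 *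
          ((w - q f) ⬝ᵥ (w - q f))) + (W.submatrix f id).det ^ 2 * (v * k / N)) := by
        refine Finset.sum_le_sum fun f _ => ?_
        -- Maps with zero minor have weight zero; for the others `q f` interpolates and is a
        -- competitor supported on the sampled set.
        by_cases h : (W.submatrix f id).det = 0
        · simp [h]
        have hsupp : ∀ i ∉ Finset.univ.image f, q f i = 0 := by
          intro i hi
          simp only [hq, ColumnSubset.interpVec, Finset.sum_apply]
          refine Finset.sum_eq_zero fun j _ => Pi.single_eq_of_ne (fun hij => hi ?_) _
          exact hij ▸ Finset.mem_image_of_mem f (Finset.mem_univ j)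
        have h1 := ColumnSubset.excessRisk_sparseOLS_le hξ X wstar _ hsupp
        rw [ColumnSubset.card_image_of_det_ne_zero h] at h1
        have h2 : W.transpose.mulVec (w - q f) = 0 := by
          rw [Matrix.mulVec_sub, ColumnSubset.transpose_mulVec_interpVec h, sub_self]
        have h3 := hSVD.mulVec_dotProduct_le hk h2
        calc _ ≤ (W.submatrix f id).det ^ 2 *
              ((s ^ 2 * ((w - q f) ⬝ᵥ (w - q f)) + v * k) / N) := by
              refine mul_le_mul_of_nonneg_left (h1.trans ?_) (sq_nonneg _)
              gcongr
          _ = _ := by ring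
    _ ≤ s ^ 2 / N * (k.factorial * ((1 + k * ((ColumnSubset.sparsityLevel W : ℝ) - k)) *
          (w ⬝ᵥ w))) + k.factorial * (v * k / N) := by
        rw [Finset.sum_add_distrib, ← Finset.mul_sum, ← Finset.sum_mul,
          ColumnSubset.sum_sq_det_submatrix, hW, Matrix.det_one, mul_one]
        have := ColumnSubset.sum_sq_det_mul_residual_le hW w
        gcongr
    _ = _ := by rw [hnorm]; ring
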